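/- All logarithms are to base 2. Let $k \ge 3$ and $n \ge k+1$, and let $G$ be a finite simple graph on $n$ vertices. Write $\mathcal{C}_G$ for the set of lengths of cycles in $G$. For an ordering $\mathcal{X} = x_1, \dots, x_n$ of $V(G)$, let $d^+(x_i)$ and $d^-(x_i)$ be the numbers of neighbours $x_j$ of $x_i$ with $j > i$ and with $j < i$, respectively. The pair $(G,\mathcal{X})$ is called a $k$-ordered graph if (1) $x_{n-1}x_n \in E(G)$, (2) $2 \le d^+(x_i) \le k$ for $1 \le i \le n-2$, and (3) $d^-(x_i) \ge 1$ for $2 \le i \le n$. The graph $G$ is called degree $k$-critical if it has exactly $(k-1)n - \binom{k}{2} + 1$ edges and no nonempty proper induced subgraph has minimum degree at least $k$. (a) If $(G,\mathcal{X})$ is a $k$-ordered graph for some ordering $\mathcal{X}$ of $V(G)$, then $$|\mathcal{C}_G| \ge \frac{\log n}{3 + \log k} - 2 .$$ (b) If $G$ is degree $k$-critical, then there is an ordering $\mathcal{X}$ of $V(G)$ such that $(G,\mathcal{X})$ is a $k$-ordered graph; consequently $|\mathcal{C}_G| \ge \frac{\log n}{3 + \log k} - 2$. -/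

import Mathlib

/-- The set of cycle lengths of a graph. -/
def cycleLengths {V : Type*} (G : SimpleGraph V) : Set ℕ :=
  {l | ∃ (v : V) (c : G.Walk v v), c.IsCycle ∧ c.length = l}

/-- The forward neighbours of the vertex `x i` with respect to the ordering
`x 0, x 1, …, x (n - 1)` of the vertices. -/
def forwardNbrs {V : Type*} {n : ℕ} (G : SimpleGraph V) (x : Fin n ≃ V) (i : Fin n) : Set V :=
  {v | G.Adj (x i) v ∧ i < x.symm v}

/-- The backward neighbours of the vertex `x i` with respect to the ordering `x`. -/
def backwardNbrs {V : Type*} {n : ℕ} (G : SimpleGraph V) (x : Fin n ≃ V) (i : Fin n) : Set V :=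
  {v | G.Adj (x i) v ∧ x.symm v < i}

/-- `(G, x)` is a `k`-ordered graph. The vertices are `x 0, …, x (n - 1)`, indexed from `0`:
the last two vertices are adjacent, every vertex other than the last two has between `2` and `k`
forward neighbours, and every vertex other than the first has a backward neighbour. -/
structure IsKOrdered {V : Type*} {n : ℕ} (k : ℕ) (G : SimpleGraph V) (x : Fin n ≃ V) : Prop where
  last_adj : ∃ i j : Fin n, (i : ℕ) + 2 = n ∧ (j : ℕ) + 1 = n ∧ G.Adj (x i) (x j)
  forward_mem : ∀ i : Fin n, (i : ℕ) + 2 < n → (forwardNbrs G x i).ncard ∈ Set.Icc 2 k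
  backward_pos : ∀ i : Fin n, 0 < (i : ℕ) → 1 ≤ (backwardNbrs G x i).ncard

/-- A finite graph on `n` vertices is degree `k`-critical (for `k ≥ 3`) if it has
`(k - 1) n - (k choose 2) + 1` edges and no proper (nonempty) induced subgraph of minimum degree
at least `k`. -/
structure IsDegreeCritical {V : Type*} (k : ℕ) (G : SimpleGraph V) : Prop where
  card_edges : (G.edgeSet.ncard : ℤ) = ((k : ℤ) - 1) * (Nat.card V : ℤ) - (k.choose 2 : ℤ) + 1
  no_proper : ¬ ∃ S : Set V, S.Nonempty ∧ S ≠ Set.univ ∧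
    ∀ v : S, k ≤ ((G.induce S).neighborSet v).ncard

/-! Let `h v` be the length of a longest increasing path from `v`, and let c be the number of cycle
lengths. Bounding the number of values of `h` and the size of each level bounds n.

Number of levels: a vertex of height t ≥ 2 lies on a cycle of length between t + 1 and 2t + 1, and
every value below the maximum of `h` is attained. Heights of the form 2^(i+2) - 1 therefore give
cycle lengths in disjoint dyadic windows, so `h v + 1 < 2 ^ (c + 2)`.

Size of a level: let each vertex choose a backward neighbour and a forward neighbour. This gives two
spanning trees. For two vertices of one level, the path in the backward tree runs through greater
heights and the path in the forward tree through smaller ones, so together they form a cycle. Its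
length is a sum of two tree metrics. By the four-point inequality and balanced splitting of the
backward tree, such a sum takes so many values that a level has at most (k + 1)^c vertices
(`card_le_pow_card_pairValues`). Hence n ≤ 2^(c+2) (k+1)^c, and logarithms give (a).

For (b), a degree critical graph has one edge more than an order with at most k - 1 forward
neighbours everywhere allows. Every proper induced subgraph has a vertex of degree below k, so an
order may start at any vertex and be degenerate afterwards; the extra edge must then occur at the
first vertex. Starting at a vertex of degree k makes every count tight. -/

open SimpleGraph

/-! ### Closing paths to cycles -/

section CycleLengths

variable {V : Type*} {G : SimpleGraph V}

/-- In a finite graph the set of cycle lengths is finite. -/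
theorem finite_cycleLengths [Fintype V] (G : SimpleGraph V) : (cycleLengths G).Finite := by
  refine (Set.finite_Iic (Fintype.card V)).subset ?_
  rintro l ⟨v, c, hc, rfl⟩
  have h := hc.support_nodup.length_le_card
  simpa using h

/-- Two nonadjacent vertices joined by two internally disjoint paths lie on a cycle. -/
theorem add_mem_cycleLengths {u v : V} (p : G.Walk u v) (q : G.Walk v u) (hp : p.IsPath)
    (hq : q.IsPath) (huv : u ≠ v) (hadj : ¬ G.Adj u v)
    (hpq : ∀ x ∈ p.support, x ∈ q.support → x = u ∨ x = v) :
    p.length + q.length ∈ cycleLengths G := by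
  cases p with
  | nil => exact absurd rfl huv
  | @cons _ w _ h p' =>
    rw [Walk.cons_isPath_iff] at hp
    refine ⟨u, Walk.cons h (p'.append q), ?_, by simp; omega⟩
    rw [Walk.cons_isCycle_iff]
    constructor
    · rw [Walk.isPath_def, Walk.support_append, List.nodup_append]
      refine ⟨hp.1.support_nodup, hq.support_nodup.tail, ?_⟩
      rintro x hx y hy rfl
      rcases hpq x (by simp [hx]) (List.mem_of_mem_tail hy) with rfl | rfl
      · exact hp.2 hx
      · have := hq.support_nodup
        rw [← Walk.cons_tail_support] at this
        exact (List.nodup_cons.1 this).1 hy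
    · rw [Walk.edges_append, List.mem_append]
      rintro (he | he)
      · exact hp.2 (p'.fst_mem_support_of_mem_edges he)
      -- If `q` used the first edge of `p`, then `w` would be `u` or `v`. Nonadjacency excludes `w =
      -- v`, where both paths could be the same edge.
      · rcases hpq w (by simp) (q.snd_mem_support_of_mem_edges he) with rfl | rfl
        · exact G.loopless.irrefl _ h
        · exact hadj h

/-- A path avoiding `v` between two neighbours of `v` closes up to a cycle through `v`. -/
theorem add_two_mem_cycleLengths {v a b : V} (p : G.Walk a b) (hp : p.IsPath) (hab : a ≠ b)
    (ha : G.Adj v a) (hb : G.Adj v b) (hv : v ∉ p.support) :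
    p.length + 2 ∈ cycleLengths G := by
  refine ⟨v, Walk.cons ha (p.concat hb.symm), ?_, by simp⟩
  rw [Walk.cons_isCycle_iff]
  refine ⟨hp.concat hv hb.symm, ?_⟩
  rw [Walk.edges_concat, List.concat_eq_append, List.mem_append]
  rintro (he | he)
  · exact hv (p.fst_mem_support_of_mem_edges he)
  · rw [List.mem_singleton, Sym2.eq_iff] at he
    rcases he with ⟨h1, -⟩ | ⟨-, h2⟩
    · exact hb.ne h1
    · exact hab h2

end CycleLengths

/-! ### Tree metrics from parent maps -/

section PointerTree

variable {V : Type*} [Fintype V] [DecidableEq V]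

open Classical in
/-- The ancestors of `v`, itself included, in the tree in which `f` maps vertices to parents. -/
noncomputable def ancestors (f : V → V) (v : V) : Finset V :=
  Finset.univ.filter fun w => ∃ i, f^[i] v = w

/-- The number of common ancestors of two vertices. -/
noncomputable def commonAncestors (f : V → V) (u v : V) : ℕ :=
  (ancestors f u ∩ ancestors f v).card

/-- The distance of two vertices in the tree in which `f` maps vertices to parents. -/
noncomputable def treeDist (f : V → V) (u v : V) : ℕ :=
  (ancestors f u).card + (ancestors f v).card - 2 * commonAncestors f u v

variable {f : V → V}

omit [DecidableEq V] in
theorem mem_ancestors {v w : V} : w ∈ ancestors f v ↔ ∃ i, f^[i] v = w := by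
  simp [ancestors]

omit [DecidableEq V] in
theorem self_mem_ancestors (v : V) : v ∈ ancestors f v := mem_ancestors.2 ⟨0, rfl⟩

omit [DecidableEq V] in
theorem ancestors_subset {u v : V} (h : u ∈ ancestors f v) : ancestors f u ⊆ ancestors f v := by
  obtain ⟨i, rfl⟩ := mem_ancestors.1 h
  intro w hw
  obtain ⟨j, rfl⟩ := mem_ancestors.1 hw
  exact mem_ancestors.2 ⟨j + i, Function.iterate_add_apply f j i v⟩

theorem ancestors_eq_insert (v : V) : ancestors f v = insert v (ancestors f (f v)) := by
  ext w
  simp only [Finset.mem_insert, mem_ancestors]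
  constructor
  · rintro ⟨i, rfl⟩
    cases i with
    | zero => exact Or.inl rfl
    | succ i => exact Or.inr ⟨i, rfl⟩
  · rintro (rfl | ⟨i, rfl⟩)
    · exact ⟨0, rfl⟩
    · exact ⟨i + 1, rfl⟩

omit [DecidableEq V] in
theorem ancestors_total {u v w : V} (hu : u ∈ ancestors f w) (hv : v ∈ ancestors f w) :
    u ∈ ancestors f v ∨ v ∈ ancestors f u := by
  obtain ⟨i, rfl⟩ := mem_ancestors.1 hu
  obtain ⟨j, rfl⟩ := mem_ancestors.1 hv
  rcases le_total i j with h | h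
  · refine Or.inr (mem_ancestors.2 ⟨j - i, ?_⟩)
    rw [← Function.iterate_add_apply, Nat.sub_add_cancel h]
  · refine Or.inl (mem_ancestors.2 ⟨i - j, ?_⟩)
    rw [← Function.iterate_add_apply, Nat.sub_add_cancel h]

-- The chain from `v` enters `c` through a child. This distributes the proper descendants of `c`
-- among its children.
omit [DecidableEq V] in
theorem exists_child_of_mem_ancestors {c v : V} (h : c ∈ ancestors f v) :
    c = v ∨ ∃ w ∈ ancestors f v, f w = c ∧ w ≠ c := by
  obtain ⟨i, hi⟩ := mem_ancestors.1 h
  induction i with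
  | zero => exact Or.inl hi.symm
  | succ i ih =>
    by_cases hc : f^[i] v = c
    · exact ih hc
    · exact Or.inr ⟨f^[i] v, mem_ancestors.2 ⟨i, rfl⟩,
        by rw [← Function.iterate_succ_apply' f i v, hi], hc⟩

theorem commonAncestors_comm (u v : V) : commonAncestors f u v = commonAncestors f v u := by
  rw [commonAncestors, commonAncestors, Finset.inter_comm]

theorem two_mul_commonAncestors_le (u v : V) :
    2 * commonAncestors f u v ≤ (ancestors f u).card + (ancestors f v).card := by
  have h1 := Finset.card_le_card (Finset.inter_subset_left (s₁ := ancestors f u)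
    (s₂ := ancestors f v))
  have h2 := Finset.card_le_card (Finset.inter_subset_right (s₁ := ancestors f u)
    (s₂ := ancestors f v))
  rw [commonAncestors]
  omega

theorem treeDist_add (u v : V) : treeDist f u v + 2 * commonAncestors f u v =
    (ancestors f u).card + (ancestors f v).card :=
  Nat.sub_add_cancel (two_mul_commonAncestors_le u v)

/-- An ultrametric inequality: the ancestors of `v` form a chain, so the common ancestors with `u`
and those with `w` are nested, and the smaller set lies in all three ancestor sets. -/
theorem min_commonAncestors_le (u v w : V) :
    min (commonAncestors f u v) (commonAncestors f v w) ≤ commonAncestors f u w := by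
  by_cases h : ancestors f u ∩ ancestors f v ⊆ ancestors f w
  · refine (min_le_left _ _).trans (Finset.card_le_card fun x hx => ?_)
    exact Finset.mem_inter.2 ⟨(Finset.mem_inter.1 hx).1, h hx⟩
  · obtain ⟨a, ha, haw⟩ := Finset.not_subset.1 h
    rw [Finset.mem_inter] at ha
    refine (min_le_right _ _).trans (Finset.card_le_card fun b hb => ?_)
    rw [Finset.mem_inter] at hb ⊢
    refine ⟨?_, hb.2⟩
    rcases ancestors_total ha.2 hb.1 with h1 | h1
    · exact absurd (ancestors_subset hb.2 h1) haw
    · exact ancestors_subset ha.1 h1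

/-- The four-point inequality for the tree metric, in terms of common ancestors. -/
theorem commonAncestors_four_point (i i' j j' : V) :
    min (commonAncestors f i j + commonAncestors f i' j')
      (commonAncestors f i j' + commonAncestors f i' j) ≤
      commonAncestors f i i' + commonAncestors f j j' := by
  have h1 := min_commonAncestors_le (f := f) i j i'
  have h2 := min_commonAncestors_le (f := f) i j' i'
  have h3 := min_commonAncestors_le (f := f) j i j'
  have h4 := min_commonAncestors_le (f := f) j i' j'
  rw [commonAncestors_comm j i'] at h1 h4
  rw [commonAncestors_comm j' i'] at h2
  rw [commonAncestors_comm j i] at h3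
  omega

/-- If `c` separates `i, i'` from `j, j'`, then the four-point inequality is strict. -/
theorem commonAncestors_four_point_strict {c i i' j j' : V} (hi : c ∈ ancestors f i)
    (hi' : c ∈ ancestors f i') (hj : c ∉ ancestors f j) (hj' : c ∉ ancestors f j') :
    commonAncestors f i j + commonAncestors f i' j' <
        commonAncestors f i i' + commonAncestors f j j' ∧
      commonAncestors f i j' + commonAncestors f i' j <
        commonAncestors f i i' + commonAncestors f j j' := by
  -- An ancestor of `x` properly below `c` cannot be an ancestor of `y`, as `c` would then be one
  -- too. So `c` can stand in for `x`.
  have key : ∀ x y : V, c ∈ ancestors f x → c ∉ ancestors f y →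
      commonAncestors f x y = commonAncestors f c y := by
    intro x y hx hy
    refine congrArg Finset.card (Finset.Subset.antisymm (fun z hz => ?_) ?_)
    · rw [Finset.mem_inter] at hz ⊢
      refine ⟨?_, hz.2⟩
      rcases ancestors_total hz.1 hx with h | h
      · exact h
      · exact absurd (ancestors_subset hz.2 h) hy
    · exact Finset.inter_subset_inter (ancestors_subset hx) le_rfl
  have lt : ∀ y : V, c ∉ ancestors f y → commonAncestors f c y < (ancestors f c).card := by
    intro y hy
    refine Finset.card_lt_card ((Finset.ssubset_iff_of_subset Finset.inter_subset_left).2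
      ⟨c, self_mem_ancestors c, fun h => hy (Finset.mem_inter.1 h).2⟩)
  have hii : (ancestors f c).card ≤ commonAncestors f i i' :=
    Finset.card_le_card (Finset.subset_inter (ancestors_subset hi) (ancestors_subset hi'))
  have hjj := min_commonAncestors_le (f := f) j c j'
  rw [commonAncestors_comm j c] at hjj
  rw [key i j hi hj, key i' j' hi' hj', key i j' hi hj', key i' j hi' hj]
  have := lt j hj
  have := lt j' hj'
  omega

/-- Two vertices of a pointer tree contained in `G` are joined by the tree path. -/
theorem exists_isPath_length_eq_treeDist {G : SimpleGraph V} {ρ : V} (r : V → ℕ)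
    (hρ : ∀ v, ρ ∈ ancestors f v)
    (hr : ∀ v, v ≠ ρ → r (f v) < r v) (hadj : ∀ v, v ≠ ρ → G.Adj v (f v)) (hfρ : f ρ = ρ)
    (u v : V) : ∃ p : G.Walk u v, p.IsPath ∧ p.length = treeDist f u v ∧
      ∀ x ∈ p.support, x ∈ ancestors f u ∪ ancestors f v := by
  have hrank : ∀ v w, w ∈ ancestors f v → w = v ∨ r w < r v := by
    intro v w hw
    obtain ⟨i, hi⟩ := mem_ancestors.1 hw
    induction i generalizing w with
    | zero => exact Or.inl hi.symm
    | succ i ih =>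
      rw [Function.iterate_succ_apply'] at hi
      have h1 := ih _ (mem_ancestors.2 ⟨i, rfl⟩) rfl
      by_cases h : f^[i] v = ρ
      · rw [h, hfρ] at hi
        rw [h, hi] at h1
        exact h1
      · have := hr _ h
        rw [hi] at this
        rcases h1 with h1 | h1
        · rw [h1] at this; exact Or.inr this
        · exact Or.inr (this.trans h1)
  have hnot : ∀ u v, u ≠ v → r v ≤ r u → u ∉ ancestors f v := by
    intro u v huv hle hmem
    rcases hrank v u hmem with h | h
    · exact huv h
    · omega
  have hne : ∀ u v, u ≠ v → r v ≤ r u → u ≠ ρ := by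
    rintro u v huv hle rfl
    exact hnot u v huv hle (hρ v)
  -- The vertex of larger rank is not an ancestor of the other, so moving it to its parent keeps the
  -- common ancestors and loses one ancestor.
  have step : ∀ u v, u ≠ v → r v ≤ r u → u ∉ ancestors f (f u) ∧
      treeDist f u v = treeDist f (f u) v + 1 := by
    intro u v huv hle
    have h1 : u ∉ ancestors f (f u) := by
      intro h
      have := hr u (hne u v huv hle)
      rcases hrank _ _ h with h | h
      · rw [← h] at this; omega
      · omega
    refine ⟨h1, ?_⟩
    have h2 := treeDist_add (f := f) u v
    have h3 := treeDist_add (f := f) (f u) v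
    have h4 : (ancestors f u).card = (ancestors f (f u)).card + 1 := by
      rw [ancestors_eq_insert u, Finset.card_insert_of_notMem h1]
    have h5 : commonAncestors f u v = commonAncestors f (f u) v := by
      rw [commonAncestors, commonAncestors, ancestors_eq_insert u,
        Finset.insert_inter_of_notMem (hnot u v huv hle)]
    omega
  have hself : ∀ u, treeDist f u u = 0 := by
    intro u
    rw [treeDist, commonAncestors, Finset.inter_self]
    omega
  have half : ∀ u v, u ≠ v → r v ≤ r u →
      (∃ p : G.Walk (f u) v, p.IsPath ∧ p.length = treeDist f (f u) v ∧
        ∀ x ∈ p.support, x ∈ ancestors f (f u) ∪ ancestors f v) →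
      ∃ p : G.Walk u v, p.IsPath ∧ p.length = treeDist f u v ∧
        ∀ x ∈ p.support, x ∈ ancestors f u ∪ ancestors f v := by
    rintro u v huv hle ⟨p, hp, hlen, hsupp⟩
    obtain ⟨h1, h2⟩ := step u v huv hle
    refine ⟨Walk.cons (hadj u (hne u v huv hle)) p, hp.cons fun h => ?_, ?_, ?_⟩
    · rcases Finset.mem_union.1 (hsupp _ h) with h | h
      · exact h1 h
      · exact hnot u v huv hle h
    · rw [Walk.length_cons, hlen, h2]
    · intro x hx
      rw [Walk.support_cons, List.mem_cons] at hx
      rcases hx with rfl | hx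
      · exact Finset.mem_union_left _ (self_mem_ancestors _)
      · rw [ancestors_eq_insert u, Finset.insert_union]
        exact Finset.mem_insert_of_mem (hsupp x hx)
  induction hn : r u + r v using Nat.strong_induction_on generalizing u v with
  | _ n ih =>
    by_cases huv : u = v
    · subst huv
      exact ⟨Walk.nil, Walk.IsPath.nil, by simp [hself], by simp [self_mem_ancestors]⟩
    rcases le_total (r v) (r u) with hle | hle
    · have := hr u (hne u v huv hle)
      exact half u v huv hle (ih _ (by omega) (f u) v rfl)
    · have := hr v (hne v u (Ne.symm huv) hle)
      obtain ⟨p, hp, hlen, hsupp⟩ := half v u (Ne.symm huv) hle (ih _ (by omega) (f v) u rfl)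
      refine ⟨p.reverse, hp.reverse, ?_, fun x hx => ?_⟩
      · rw [Walk.length_reverse, hlen, treeDist, treeDist, commonAncestors_comm, add_comm]
      · rw [Finset.union_comm]
        exact hsupp x (by simpa using hx)

end PointerTree

/-! ### Heights and cycles of controlled length -/

section ForwardHeight

variable {V : Type*} [LinearOrder V] [Finite V]

/-- `h v` is the length of a longest increasing path of `G` that starts at `v`. -/
structure IsForwardHeight (G : SimpleGraph V) (h : V → ℕ) : Prop where
  lt_of_adj : ∀ v w, G.Adj v w → v < w → h w < h v
  exists_adj : ∀ v, h v ≠ 0 → ∃ w, G.Adj v w ∧ v < w ∧ h v = h w + 1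

theorem exists_isForwardHeight (G : SimpleGraph V) : ∃ h : V → ℕ, IsForwardHeight G h := by
  classical
  have : Fintype V := Fintype.ofFinite V
  -- The recursion runs down from the largest vertex; a backward neighbour contributes 0, which does
  -- not change the supremum.
  let F : (v : V) → ((w : V) → v < w → ℕ) → ℕ := fun v ih =>
    (Finset.univ.filter fun w => G.Adj v w).sup fun w => if hw : v < w then ih w hw + 1 else 0
  let h : V → ℕ := (wellFounded_gt (α := V)).fix F
  have hfix : ∀ v, h v = (Finset.univ.filter fun w => G.Adj v w).sup
      fun w => if v < w then h w + 1 else 0 := by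
    intro v
    have := (wellFounded_gt (α := V)).fix_eq F v
    simpa [F, h] using this
  refine ⟨h, fun v w hvw hlt => ?_, fun v hv => ?_⟩
  · rw [hfix v]
    refine lt_of_lt_of_le ?_ (Finset.le_sup (b := w) (by simpa using hvw))
    simp [hlt]
  · have hne : (Finset.univ.filter fun w => G.Adj v w).Nonempty := by
      by_contra hne
      rw [Finset.not_nonempty_iff_eq_empty] at hne
      rw [hfix v, hne] at hv
      simp at hv
    obtain ⟨w, hw, hsup⟩ := Finset.exists_mem_eq_sup _ hne
      fun w => if v < w then h w + 1 else 0
    rw [← hfix v] at hsup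
    by_cases hlt : v < w
    · exact ⟨w, by simpa using hw, hlt, by simpa [hlt] using hsup⟩
    · simp [hlt] at hsup
      exact absurd hsup hv

variable {G : SimpleGraph V} {h : V → ℕ}

omit [Finite V] in
theorem IsForwardHeight.exists_eq (hh : IsForwardHeight G h) {t : ℕ} {v : V} (hv : t ≤ h v) :
    ∃ w, h w = t := by
  obtain ⟨m, hm⟩ := Nat.exists_eq_add_of_le hv
  induction m generalizing v with
  | zero => exact ⟨v, hm⟩
  | succ m ih =>
    obtain ⟨w, -, -, hw⟩ := hh.exists_adj v (by omega)
    exact ih (v := w) (by omega) (by omega)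

/-- Distinct vertices are joined by a path in the part of the graph above them whose length is
controlled by their heights. -/
theorem IsForwardHeight.exists_isPath (hh : IsForwardHeight G h) {y z : V} (hyz : y < z)
    (hadj : G.Adj y z) (hlast : ∀ v, v < y ∨ v = y ∨ v = z)
    (hfwd : ∀ v, v < y → ∃ a b, a ≠ b ∧ (G.Adj v a ∧ v < a) ∧ (G.Adj v b ∧ v < b))
    (a b : V) (hab : a ≠ b) :
    ∃ p : G.Walk a b, p.IsPath ∧ (∀ x ∈ p.support, min a b ≤ x) ∧
      max (h a) (h b) ≤ p.length ∧ p.length ≤ h a + h b + 1 := by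
  have hz : h z = 0 := by
    by_contra h0
    obtain ⟨w, -, hw, -⟩ := hh.exists_adj z h0
    rcases hlast w with h1 | rfl | rfl
    · exact absurd (hw.trans h1) hyz.not_gt
    · exact absurd hw hyz.not_gt
    · exact lt_irrefl _ hw
  have hy : h y = 1 := by
    have h0 : h y ≠ 0 := by
      have := hh.lt_of_adj y z hadj hyz
      omega
    obtain ⟨w, -, hw, he⟩ := hh.exists_adj y h0
    rcases hlast w with h1 | rfl | rfl
    · exact absurd hw h1.not_gt
    · exact absurd hw (lt_irrefl _)
    · omega
  have key : ∀ a b : V, a < b → ∃ p : G.Walk a b, p.IsPath ∧ (∀ x ∈ p.support, a ≤ x) ∧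
      max (h a) (h b) ≤ p.length ∧ p.length ≤ h a + h b + 1 := by
    intro a
    induction a using (wellFounded_gt (α := V)).induction with
    | _ a ih =>
      intro b hab
      have ih' : ∀ c, a < c → c ≠ b → ∃ p : G.Walk c b, p.IsPath ∧ (∀ x ∈ p.support, a < x) ∧
          max (h c) (h b) ≤ p.length ∧ p.length ≤ h c + h b + 1 := by
        intro c hac hcb
        rcases lt_or_gt_of_ne hcb with hlt | hlt
        · obtain ⟨p, h1, h2, h3, h4⟩ := ih c hac b hlt
          exact ⟨p, h1, fun x hx => hac.trans_le (h2 x hx), h3, h4⟩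
        · obtain ⟨p, h1, h2, h3, h4⟩ := ih b hab c hlt
          refine ⟨p.reverse, h1.reverse, fun x hx => hab.trans_le (h2 x (by simpa using hx)), ?_, ?_⟩
          · rw [Walk.length_reverse, max_comm]; exact h3
          · rw [Walk.length_reverse]; omega
      have extend : ∀ c, G.Adj a c → ∀ p : G.Walk c b, p.IsPath → (∀ x ∈ p.support, a < x) →
          ∃ q : G.Walk a b, q.IsPath ∧ (∀ x ∈ q.support, a ≤ x) ∧ q.length = p.length + 1 := by
        intro c hac p hp hx
        refine ⟨Walk.cons hac p, hp.cons fun h => lt_irrefl _ (hx a h), fun x hx' => ?_, by simp⟩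
        rw [Walk.support_cons, List.mem_cons] at hx'
        rcases hx' with rfl | hx'
        · exact le_rfl
        · exact (hx x hx').le
      rcases hlast a with hay | rfl | rfl
      · obtain ⟨c, d, hcd, hc, hd⟩ := hfwd a hay
        have h0 : h a ≠ 0 := by
          have := hh.lt_of_adj a c hc.1 hc.2
          omega
        obtain ⟨w, haw, hlt, he⟩ := hh.exists_adj a h0
        -- A path from `w` has the right length, since `h w = h a - 1`. If `w` is the target,
        -- another forward neighbour `u` serves: the lower bound then comes from `h b = h a - 1`,
        -- the upper one from `h u ≤ h a - 1`.
        by_cases hwb : w = b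
        · obtain ⟨u, hu, hub⟩ : ∃ u, (G.Adj a u ∧ a < u) ∧ u ≠ b := by
            by_cases hcb : c = b
            · exact ⟨d, hd, fun h => hcd (hcb.trans h.symm)⟩
            · exact ⟨c, hc, hcb⟩
          obtain ⟨p, h1, h2, h3, h4⟩ := ih' u hu.2 hub
          obtain ⟨q, g1, g2, g3⟩ := extend u hu.1 p h1 h2
          have := hh.lt_of_adj a u hu.1 hu.2
          subst hwb
          exact ⟨q, g1, g2, by omega, by omega⟩
        · obtain ⟨p, h1, h2, h3, h4⟩ := ih' w hlt hwb
          obtain ⟨q, g1, g2, g3⟩ := extend w haw p h1 h2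
          exact ⟨q, g1, g2, by omega, by omega⟩
      · obtain rfl : b = z := by
          rcases hlast b with h1 | h1 | h1
          · exact absurd hab h1.not_gt
          · exact absurd h1.symm hab.ne
          · exact h1
        refine ⟨Walk.cons hadj Walk.nil, ?_, ?_, ?_, ?_⟩
        · simp [hab.ne]
        · simp [hab.le]
        · simp [hy, hz]
        · simp
      · rcases hlast b with h1 | rfl | rfl
        · exact absurd (hab.trans h1) hyz.not_gt
        · exact absurd hab hyz.not_gt
        · exact absurd hab (lt_irrefl _)
  rcases lt_or_gt_of_ne hab with hlt | hlt
  · obtain ⟨p, h1, h2, h3⟩ := key a b hlt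
    exact ⟨p, h1, by rwa [min_eq_left hlt.le], h3⟩
  · obtain ⟨p, h1, h2, h3, h4⟩ := key b a hlt
    refine ⟨p.reverse, h1.reverse, fun x hx => ?_, ?_, ?_⟩
    · rw [min_eq_right hlt.le]
      exact h2 x (by simpa using hx)
    · rw [Walk.length_reverse, max_comm]; exact h3
    · rw [Walk.length_reverse]; omega

/-- A vertex of height `t ≥ 2` lies on a cycle of length between `t + 1` and `2 * t + 1`. -/
theorem IsForwardHeight.exists_mem_cycleLengths (hh : IsForwardHeight G h) {y z : V} (hyz : y < z)
    (hadj : G.Adj y z) (hlast : ∀ v, v < y ∨ v = y ∨ v = z)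
    (hfwd : ∀ v, v < y → ∃ a b, a ≠ b ∧ (G.Adj v a ∧ v < a) ∧ (G.Adj v b ∧ v < b))
    (v : V) (hv : v < y) :
    ∃ l ∈ cycleLengths G, h v + 1 ≤ l ∧ l ≤ 2 * h v + 1 := by
  obtain ⟨c, d, hcd, hc, hd⟩ := hfwd v hv
  have h0 : h v ≠ 0 := by
    have := hh.lt_of_adj v c hc.1 hc.2
    omega
  obtain ⟨w, hvw, hlt, he⟩ := hh.exists_adj v h0
  obtain ⟨u, hu, huw⟩ : ∃ u, (G.Adj v u ∧ v < u) ∧ u ≠ w := by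
    by_cases hcb : c = w
    · exact ⟨d, hd, fun h => hcd (hcb.trans h.symm)⟩
    · exact ⟨c, hc, hcb⟩
  obtain ⟨p, h1, h2, h3, h4⟩ := hh.exists_isPath hyz hadj hlast hfwd u w huw
  have := hh.lt_of_adj v u hu.1 hu.2
  -- As `h w = h v - 1` and `h u ≤ h v - 1`, the path has length between `h v - 1` and `2 * h v -
  -- 1`; the two edges at `v` add 2.
  refine ⟨p.length + 2, add_two_mem_cycleLengths p h1 huw hu.1 hvw fun hx => ?_,
    by omega, by omega⟩
  exact absurd (h2 v hx) (not_le.2 (lt_min hu.2 hlt))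

/-- The height is at most exponential in the number of cycle lengths. -/
theorem IsForwardHeight.lt_two_pow (hh : IsForwardHeight G h) {y z : V} (hyz : y < z)
    (hadj : G.Adj y z) (hlast : ∀ v, v < y ∨ v = y ∨ v = z)
    (hfwd : ∀ v, v < y → ∃ a b, a ≠ b ∧ (G.Adj v a ∧ v < a) ∧ (G.Adj v b ∧ v < b))
    (v : V) : h v + 1 < 2 ^ ((cycleLengths G).ncard + 2) := by
  have : Fintype V := Fintype.ofFinite V
  by_contra hcon
  have hz : ∀ w, y ≤ w → h w ≤ 1 := by
    intro w hw
    by_contra h2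
    obtain ⟨w₁, -, hlt, he⟩ := hh.exists_adj w (by omega)
    obtain ⟨w₂, -, hlt', -⟩ := hh.exists_adj w₁ (by omega)
    rcases hlast w₁ with h1 | rfl | rfl
    · exact absurd (hw.trans_lt hlt) h1.not_gt
    · exact absurd (hw.trans_lt hlt) (lt_irrefl _)
    · rcases hlast w₂ with h1 | rfl | rfl
      · exact absurd (hlt'.trans h1) hyz.not_gt
      · exact absurd hlt' hyz.not_gt
      · exact absurd hlt' (lt_irrefl _)
  set c := (cycleLengths G).ncard with hc
  -- A vertex of height 2^(i+2) - 1 ≥ 3 precedes `y`, and its cycle has length between 2^(i+2) and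
  -- 2^(i+3) - 1. The c + 1 windows are disjoint, one too many.
  have hex : ∀ i : ℕ, i ≤ c → ∃ l ∈ cycleLengths G, 2 ^ (i + 2) ≤ l ∧ l < 2 ^ (i + 3) := by
    intro i hi
    have hle : 2 ^ (i + 2) ≤ 2 ^ (c + 2) := Nat.pow_le_pow_right (by norm_num) (by omega)
    have hpos : 4 ≤ 2 ^ (i + 2) := by
      have := Nat.pow_le_pow_right (n := 2) (by norm_num) (show 2 ≤ i + 2 by omega)
      simpa using this
    obtain ⟨w, hw⟩ := hh.exists_eq (t := 2 ^ (i + 2) - 1) (v := v) (by omega)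
    have hwy : w < y := by
      by_contra hwy
      have := hz w (not_lt.1 hwy)
      omega
    obtain ⟨l, hl, h1, h2⟩ := hh.exists_mem_cycleLengths hyz hadj hlast hfwd w hwy
    refine ⟨l, hl, by omega, ?_⟩
    have : 2 ^ (i + 3) = 2 * 2 ^ (i + 2) := by rw [pow_succ 2 (i + 2), mul_comm]
    omega
  choose! l hl hlow hupp using hex
  have hinj : Set.InjOn l (Finset.range (c + 1) : Finset ℕ) := by
    intro i hi j hj hij
    simp only [Finset.coe_range, Set.mem_Iio] at hi hj
    have h1 := hlow i (by omega)
    have h2 := hupp j (by omega)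
    have h3 := hlow j (by omega)
    have h4 := hupp i (by omega)
    rw [hij] at h1 h4
    have h5 := (Nat.pow_lt_pow_iff_right (a := 2) (by norm_num)).1 (h1.trans_lt h2)
    have h6 := (Nat.pow_lt_pow_iff_right (a := 2) (by norm_num)).1 (h3.trans_lt h4)
    omega
  have hcard := Set.ncard_le_ncard (s := ((Finset.range (c + 1)).image l : Finset ℕ))
    (t := cycleLengths G) (by
      intro x hx
      simp only [Finset.coe_image, Set.mem_image, Finset.coe_range, Set.mem_Iio] at hx
      obtain ⟨i, hi, rfl⟩ := hx
      exact hl i (by omega)) (finite_cycleLengths G)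
  rw [Set.ncard_coe_finset, Finset.card_image_of_injOn hinj, Finset.card_range] at hcard
  omega

end ForwardHeight

/-! ### Sums of tree metrics and the size of a level -/

section PairValues

variable {V : Type*}

/-- The set of values that `d` takes on pairs of distinct elements of `S`. -/
def pairValues (d : V → V → ℕ) (S : Finset V) : Finset ℕ :=
  S.offDiag.image fun p => d p.1 p.2

theorem mem_pairValues {d : V → V → ℕ} {S : Finset V} {l : ℕ} :
    l ∈ pairValues d S ↔ ∃ i ∈ S, ∃ j ∈ S, i ≠ j ∧ d i j = l := by
  simp [pairValues, and_assoc]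

theorem pairValues_mono {d : V → V → ℕ} {S T : Finset V} (h : S ⊆ T) :
    pairValues d S ⊆ pairValues d T :=
  Finset.image_subset_image (Finset.offDiag_mono h)

end PairValues

section Levels

variable {V : Type*} [LinearOrder V] [Fintype V]

theorem root_mem_ancestors {f : V → V} {ρ : V} (r : V → ℕ)
    (hr : ∀ v, v ≠ ρ → r (f v) < r v) (v : V) : ρ ∈ ancestors f v := by
  induction hn : r v using Nat.strong_induction_on generalizing v with
  | _ n ih =>
    by_cases hv : v = ρ
    · exact hv ▸ self_mem_ancestors v
    · rw [ancestors_eq_insert]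
      exact Finset.mem_insert_of_mem (ih _ (hn ▸ hr v hv) (f v) rfl)

/-- A vertex of a tree with at most `k` children at each vertex whose descendants and
nondescendants both make up at least a `1 / (k + 1)` fraction of a given antichain. -/
theorem exists_balanced_vertex {f : V → V} {ρ : V} {k : ℕ} (hk : 1 ≤ k)
    (hfρ : f ρ = ρ) (hlt : ∀ v, v ≠ ρ → f v < v) (hρ : ∀ v, ρ ∈ ancestors f v)
    (hchild : ∀ c, (Finset.univ.filter fun v => f v = c ∧ v ≠ c).card ≤ k)
    (S : Finset V) (hS : ∀ i ∈ S, ∀ j ∈ S, j ∈ ancestors f i → j = i) (hcard : 2 ≤ S.card) :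
    ∃ c, S.card ≤ (k + 1) * (S.filter fun i => c ∈ ancestors f i).card ∧
      S.card ≤ (k + 1) * (S.filter fun i => ¬ c ∈ ancestors f i).card := by
  classical
  have hne : (Finset.univ.filter fun c =>
      S.card ≤ (k + 1) * (S.filter fun i => c ∈ ancestors f i).card).Nonempty := by
    refine ⟨ρ, Finset.mem_filter.2 ⟨Finset.mem_univ _, ?_⟩⟩
    rw [Finset.filter_true_of_mem fun i _ => hρ i]
    exact Nat.le_mul_of_pos_left _ (by omega)
  -- Children exceed their parents in the order, so by maximality no child of `c` has its share of
  -- `S`. At most `k` children then leave enough of `S` outside `c`.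
  obtain ⟨c, hc, hmax⟩ := Finset.exists_max_image _ id hne
  rw [Finset.mem_filter] at hc
  refine ⟨c, hc.2, ?_⟩
  have hsum := Finset.card_filter_add_card_filter_not (s := S) (fun i => c ∈ ancestors f i)
  by_cases hcS : c ∈ S
  · have h1 : (S.filter fun i => c ∈ ancestors f i).card ≤ 1 := by
      refine Finset.card_le_one.2 fun a ha b hb => ?_
      rw [Finset.mem_filter] at ha hb
      rw [← hS a ha.1 c hcS ha.2, ← hS b hb.1 c hcS hb.2]
    nlinarith
  · have hsub : (S.filter fun i => c ∈ ancestors f i) ⊆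
        (Finset.univ.filter fun v => f v = c ∧ v ≠ c).biUnion
          fun v => S.filter fun i => v ∈ ancestors f i := by
      intro i hi
      rw [Finset.mem_filter] at hi
      rcases exists_child_of_mem_ancestors hi.2 with rfl | ⟨w, hw, hwc, hne⟩
      · exact absurd hi.1 hcS
      · simp only [Finset.mem_biUnion, Finset.mem_filter, Finset.mem_univ, true_and]
        exact ⟨w, ⟨hwc, hne⟩, hi.1, hw⟩
    have h1 : (k + 1) * (S.filter fun i => c ∈ ancestors f i).card ≤ k * S.card := by
      calc (k + 1) * (S.filter fun i => c ∈ ancestors f i).card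
          ≤ (k + 1) * ∑ v ∈ Finset.univ.filter fun v => f v = c ∧ v ≠ c,
              (S.filter fun i => v ∈ ancestors f i).card :=
            Nat.mul_le_mul_left _ ((Finset.card_le_card hsub).trans Finset.card_biUnion_le)
        _ = ∑ v ∈ Finset.univ.filter fun v => f v = c ∧ v ≠ c,
              (k + 1) * (S.filter fun i => v ∈ ancestors f i).card := Finset.mul_sum _ _ _
        _ ≤ (Finset.univ.filter fun v => f v = c ∧ v ≠ c).card • S.card := by
            refine Finset.sum_le_card_nsmul _ _ _ fun v hv => ?_
            rw [Finset.mem_filter] at hv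
            by_contra hcon
            have := hmax v (Finset.mem_filter.2 ⟨Finset.mem_univ _, (not_le.1 hcon).le⟩)
            have hvρ : v ≠ ρ := by
              rintro rfl
              exact hv.2.2 (hfρ ▸ hv.2.1)
            have h2 := hlt v hvρ
            rw [hv.2.1] at h2
            exact absurd this (not_le.2 h2)
        _ ≤ k * S.card := Nat.mul_le_mul_right _ (hchild c)
    have h2 : (k + 1) * (S.filter fun i => c ∈ ancestors f i).card +
        (k + 1) * (S.filter fun i => ¬ c ∈ ancestors f i).card = (k + 1) * S.card := by
      rw [← mul_add, hsum]
    have h3 : (k + 1) * S.card = k * S.card + S.card := by ring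
    omega

/-- The sum of two tree metrics, one of which comes from a tree with at most `k` children at each
vertex, takes many values on a large antichain. -/
theorem card_le_pow_card_pairValues {f g : V → V} {ρ : V} {k : ℕ} (hk : 1 ≤ k)
    (hfρ : f ρ = ρ) (hlt : ∀ v, v ≠ ρ → f v < v) (hρ : ∀ v, ρ ∈ ancestors f v)
    (hchild : ∀ c, (Finset.univ.filter fun v => f v = c ∧ v ≠ c).card ≤ k)
    (S : Finset V) (hS : ∀ i ∈ S, ∀ j ∈ S, j ∈ ancestors f i → j = i) :
    S.card ≤ (k + 1) ^ (pairValues (fun i j => treeDist f i j + treeDist g i j) S).card := by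
  classical
  set d : V → V → ℕ := fun i j => treeDist f i j + treeDist g i j with hd
  induction hn : S.card using Nat.strong_induction_on generalizing S with
  | _ n ih =>
    subst hn
    rcases Nat.lt_or_ge S.card 2 with hsmall | hcard
    · exact (Nat.le_of_lt_succ hsmall).trans (Nat.one_le_pow _ _ (by omega))
    obtain ⟨c, h1, h2⟩ := exists_balanced_vertex hk hfρ hlt hρ hchild S hS hcard
    set A := S.filter fun i => c ∈ ancestors f i with hA
    set B := S.filter fun i => ¬ c ∈ ancestors f i with hB
    have hAS : A ⊆ S := Finset.filter_subset _ _
    have hBS : B ⊆ S := Finset.filter_subset _ _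
    have hsum : A.card + B.card = S.card := Finset.card_filter_add_card_filter_not _
    have hApos : 0 < A.card := by
      by_contra h0
      have : A.card = 0 := by omega
      rw [this] at h1
      omega
    have hBpos : 0 < B.card := by
      by_contra h0
      have : B.card = 0 := by omega
      rw [this] at h2
      omega
    have hAn : A.Nonempty := Finset.card_pos.1 hApos
    have hBn : B.Nonempty := Finset.card_pos.1 hBpos
    -- The largest cross value is the one that will be missing inside `A` or inside `B`; induction
    -- then applies to that part with one value fewer.
    obtain ⟨⟨a, b⟩, hab, hmax⟩ := Finset.exists_max_image (A ×ˢ B) (fun p => d p.1 p.2)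
      (hAn.product hBn)
    rw [Finset.mem_product] at hab
    have hmem : d a b ∈ pairValues d S := by
      refine mem_pairValues.2 ⟨a, hAS hab.1, b, hBS hab.2, ?_, rfl⟩
      rintro rfl
      exact (Finset.mem_filter.1 hab.2).2 (Finset.mem_filter.1 hab.1).2
    have finish : ∀ C ⊆ S, C.card < S.card → S.card ≤ (k + 1) * C.card →
        d a b ∉ pairValues d C → S.card ≤ (k + 1) ^ (pairValues d S).card := by
      intro C hCS hlt' hle hnot
      have h3 : (pairValues d C).card + 1 ≤ (pairValues d S).card := by
        refine Finset.card_lt_card ((Finset.ssubset_iff_of_subset (pairValues_mono hCS)).2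
          ⟨_, hmem, hnot⟩)
      calc S.card ≤ (k + 1) * C.card := hle
        _ ≤ (k + 1) * (k + 1) ^ (pairValues d C).card :=
            Nat.mul_le_mul_left _ (ih _ hlt' C
              (fun i hi j hj => hS i (hCS hi) j (hCS hj)) rfl)
        _ = (k + 1) ^ ((pairValues d C).card + 1) := by rw [pow_succ, mul_comm]
        _ ≤ (k + 1) ^ (pairValues d S).card := Nat.pow_le_pow_right (by omega) h3
    -- If the maximum M occurred inside both parts, the two inner distances would sum to 2M. The
    -- four-point inequality, strict for `f` because `c` separates the pairs, puts that sum strictly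
    -- below one of the cross sums, each at most 2M.
    by_cases hAv : d a b ∈ pairValues d A
    · refine finish B hBS (by omega) h2 fun hBv => ?_
      obtain ⟨i, hi, i', hi', -, hii⟩ := mem_pairValues.1 hAv
      obtain ⟨j, hj, j', hj', -, hjj⟩ := mem_pairValues.1 hBv
      have m1 : d i j ≤ d a b := hmax (i, j) (Finset.mem_product.2 ⟨hi, hj⟩)
      have m2 : d i' j' ≤ d a b := hmax (i', j') (Finset.mem_product.2 ⟨hi', hj'⟩)
      have m3 : d i j' ≤ d a b := hmax (i, j') (Finset.mem_product.2 ⟨hi, hj'⟩)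
      have m4 : d i' j ≤ d a b := hmax (i', j) (Finset.mem_product.2 ⟨hi', hj⟩)
      obtain ⟨s1, s2⟩ := commonAncestors_four_point_strict (f := f) (Finset.mem_filter.1 hi).2
        (Finset.mem_filter.1 hi').2 (Finset.mem_filter.1 hj).2 (Finset.mem_filter.1 hj').2
      have s3 := commonAncestors_four_point (f := g) i i' j j'
      have t1 := treeDist_add (f := f) i i'
      have t2 := treeDist_add (f := f) j j'
      have t3 := treeDist_add (f := f) i j
      have t4 := treeDist_add (f := f) i' j'
      have t5 := treeDist_add (f := f) i j'
      have t6 := treeDist_add (f := f) i' j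
      have u1 := treeDist_add (f := g) i i'
      have u2 := treeDist_add (f := g) j j'
      have u3 := treeDist_add (f := g) i j
      have u4 := treeDist_add (f := g) i' j'
      have u5 := treeDist_add (f := g) i j'
      have u6 := treeDist_add (f := g) i' j
      simp only [hd] at m1 m2 m3 m4 hii hjj
      omega
    · exact finish A hAS (by omega) h1 hAv

variable {G : SimpleGraph V}

/-- In a graph on a linear order with few forward neighbours at each vertex, the number of vertices
is at most exponential in the number of cycle lengths. -/
theorem card_le_of_forward_backward {y z ρ : V} {k : ℕ} (hk : 1 ≤ k) (hyz : y < z)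
    (hadj : G.Adj y z) (hlast : ∀ v, v < y ∨ v = y ∨ v = z)
    (hfwd : ∀ v, v < y → ∃ a b, a ≠ b ∧ (G.Adj v a ∧ v < a) ∧ (G.Adj v b ∧ v < b))
    (hbwd : ∀ v, v ≠ ρ → ∃ u, G.Adj v u ∧ u < v)
    (hcard : ∀ v, {w | G.Adj v w ∧ v < w}.ncard ≤ k) :
    Fintype.card V ≤
      2 ^ ((cycleLengths G).ncard + 2) * (k + 1) ^ (cycleLengths G).ncard := by
  classical
  obtain ⟨h, hh⟩ := exists_isForwardHeight G
  have hbound := hh.lt_two_pow hyz hadj hlast hfwd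
  have hnext : ∀ v, v ≠ z → ∃ w, G.Adj v w ∧ v < w := by
    intro v hv
    rcases hlast v with h1 | rfl | h1
    · obtain ⟨a, -, -, ha, -⟩ := hfwd v h1
      exact ⟨a, ha⟩
    · exact ⟨z, hadj, hyz⟩
    · exact absurd h1 hv
  choose! f₀ hf₀ using hbwd
  choose! g₀ hg₀ using hnext
  let f : V → V := fun v => if v = ρ then ρ else f₀ v
  let g : V → V := fun v => if v = z then z else g₀ v
  have hfρ : f ρ = ρ := if_pos rfl
  have hgz : g z = z := if_pos rfl
  have hf : ∀ v, v ≠ ρ → G.Adj v (f v) ∧ f v < v := fun v hv => by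
    simp only [f, if_neg hv]; exact hf₀ v hv
  have hg : ∀ v, v ≠ z → G.Adj v (g v) ∧ v < g v := fun v hv => by
    simp only [g, if_neg hv]; exact hg₀ v hv
  let r : V → ℕ := fun v => (Finset.univ.filter fun w => w < v).card
  have hr : ∀ u v, u < v → r u < r v := fun u v huv => by
    refine Finset.card_lt_card ((Finset.ssubset_iff_of_subset fun w hw => ?_).2 ⟨u, ?_, ?_⟩)
    · simp only [Finset.mem_filter, Finset.mem_univ, true_and] at hw ⊢
      exact hw.trans huv
    · simpa using huv
    · simp
  have hrf : ∀ v, v ≠ ρ → r (f v) < r v := fun v hv => hr _ _ (hf v hv).2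
  have hhg : ∀ v, v ≠ z → h (g v) < h v := fun v hv =>
    hh.lt_of_adj v (g v) (hg v hv).1 (hg v hv).2
  have hρf := root_mem_ancestors (f := f) r hrf
  have hzg := root_mem_ancestors (f := g) h hhg
  -- A step back along an edge raises the height, and a step of `g` lowers it. So the two tree paths
  -- between vertices of one level meet only at their ends, and a level is an antichain for `f`.
  have hancf : ∀ v w, w ∈ ancestors f v → w = v ∨ h v < h w := by
    intro v w hw
    obtain ⟨i, hi⟩ := mem_ancestors.1 hw
    induction i generalizing v with
    | zero => exact Or.inl hi.symm
    | succ i ih =>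
      rw [Function.iterate_succ_apply] at hi
      by_cases hv : v = ρ
      · rw [hv, hfρ] at hi
        rw [hv]
        exact ih ρ (mem_ancestors.2 ⟨i, hi⟩) hi
      · have h1 := hh.lt_of_adj (f v) v (hf v hv).1.symm (hf v hv).2
        rcases ih (f v) (mem_ancestors.2 ⟨i, hi⟩) hi with rfl | h2
        · exact Or.inr h1
        · exact Or.inr (h1.trans h2)
  have hancg : ∀ v w, w ∈ ancestors g v → w = v ∨ h w < h v := by
    intro v w hw
    obtain ⟨i, hi⟩ := mem_ancestors.1 hw
    induction i generalizing v with
    | zero => exact Or.inl hi.symm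
    | succ i ih =>
      rw [Function.iterate_succ_apply] at hi
      by_cases hv : v = z
      · rw [hv, hgz] at hi
        rw [hv]
        exact ih z (mem_ancestors.2 ⟨i, hi⟩) hi
      · have h1 := hhg v hv
        rcases ih (g v) (mem_ancestors.2 ⟨i, hi⟩) hi with rfl | h2
        · exact Or.inr h1
        · exact Or.inr (h2.trans h1)
  have hchild : ∀ c, (Finset.univ.filter fun v => f v = c ∧ v ≠ c).card ≤ k := by
    intro c
    refine le_trans ?_ (hcard c)
    rw [← Set.ncard_coe_finset]
    refine Set.ncard_le_ncard (fun v hv => ?_) (Set.toFinite _)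
    simp only [Finset.coe_filter, Finset.mem_univ, true_and, Set.mem_ofPred_eq] at hv ⊢
    have hvρ : v ≠ ρ := by
      rintro rfl
      exact hv.2 (hfρ ▸ hv.1)
    rw [← hv.1]
    exact ⟨(hf v hvρ).1.symm, (hf v hvρ).2⟩
  have hcycle : ∀ i j, i ≠ j → h i = h j →
      treeDist f i j + treeDist g i j ∈ cycleLengths G := by
    intro i j hij hlevel
    obtain ⟨p, hp, hplen, hps⟩ := exists_isPath_length_eq_treeDist (G := G) r hρf hrf
      (fun v hv => (hf v hv).1) hfρ i j
    obtain ⟨q, hq, hqlen, hqs⟩ := exists_isPath_length_eq_treeDist (G := G) h hzg hhg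
      (fun v hv => (hg v hv).1) hgz j i
    have hnadj : ¬ G.Adj i j := by
      intro hadj'
      rcases lt_or_gt_of_ne hij with hlt | hlt
      · have := hh.lt_of_adj i j hadj' hlt
        omega
      · have := hh.lt_of_adj j i hadj'.symm hlt
        omega
    have hmem := add_mem_cycleLengths p q hp hq hij hnadj (by
      intro x hx hx'
      have h1 : x = i ∨ x = j ∨ h i < h x := by
        rcases Finset.mem_union.1 (hps x hx) with h1 | h1
        · rcases hancf _ _ h1 with h2 | h2
          · exact Or.inl h2
          · exact Or.inr (Or.inr h2)
        · rcases hancf _ _ h1 with h2 | h2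
          · exact Or.inr (Or.inl h2)
          · exact Or.inr (Or.inr (by omega))
      have h2 : x = i ∨ x = j ∨ h x < h i := by
        rcases Finset.mem_union.1 (hqs x hx') with h1 | h1
        · rcases hancg _ _ h1 with h2 | h2
          · exact Or.inr (Or.inl h2)
          · exact Or.inr (Or.inr (by omega))
        · rcases hancg _ _ h1 with h2 | h2
          · exact Or.inl h2
          · exact Or.inr (Or.inr h2)
      rcases h1 with h1 | h1 | h1
      · exact Or.inl h1
      · exact Or.inr h1
      · rcases h2 with h2 | h2 | h2
        · exact Or.inl h2
        · exact Or.inr h2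
        · omega)
    rw [hplen, hqlen] at hmem
    have hcomm : treeDist g j i = treeDist g i j := by
      rw [treeDist, treeDist, commonAncestors_comm, add_comm]
    rwa [hcomm] at hmem
  have hlevel : ∀ l, (Finset.univ.filter fun v => h v = l).card ≤
      (k + 1) ^ (cycleLengths G).ncard := by
    intro l
    refine (card_le_pow_card_pairValues (g := g) hk hfρ (fun v hv => (hf v hv).2) hρf hchild _
      ?_).trans (Nat.pow_le_pow_right (by omega) ?_)
    · intro i hi j hj hij
      simp only [Finset.mem_filter, Finset.mem_univ, true_and] at hi hj
      rcases hancf _ _ hij with h1 | h1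
      · exact h1
      · omega
    · rw [← Set.ncard_coe_finset]
      refine Set.ncard_le_ncard (fun m hm => ?_) (finite_cycleLengths G)
      obtain ⟨i, hi, j, hj, hij, rfl⟩ := mem_pairValues.1 (Finset.mem_coe.1 hm)
      simp only [Finset.mem_filter, Finset.mem_univ, true_and] at hi hj
      exact hcycle i j hij (hi.trans hj.symm)
  have hcount := Finset.card_le_mul_card_image_of_maps_to (s := (Finset.univ : Finset V))
    (t := Finset.range (2 ^ ((cycleLengths G).ncard + 2))) (f := h)
    (fun v _ => Finset.mem_range.2 (by have := hbound v; omega)) ((k + 1) ^ (cycleLengths G).ncard)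
    (fun l _ => hlevel l)
  rwa [Finset.card_univ, Finset.card_range, mul_comm] at hcount

end Levels

/-- The number of cycle lengths of a `k`-ordered graph is at least logarithmic in the number of
vertices. -/
theorem logb_le_of_isKOrdered {V : Type*} [Fintype V] (G : SimpleGraph V) (k n : ℕ)
    (hk : 3 ≤ k) (hV : Fintype.card V = n) (x : Fin n ≃ V)
    (hx : IsKOrdered k G x) :
    Real.logb 2 n / (3 + Real.logb 2 k) - 2 ≤ ((cycleLengths G).ncard : ℝ) := by
  let _ : LinearOrder V := LinearOrder.lift' x.symm x.symm.injective
  have hlt : ∀ u v : V, u < v ↔ x.symm u < x.symm v := fun u v => Iff.rfl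
  obtain ⟨i₀, j₀, hi₀, hj₀, hij⟩ := hx.last_adj
  have hcardlast : ∀ v : V, v < x i₀ ∨ v = x i₀ ∨ v = x j₀ := by
    intro v
    rw [hlt, Equiv.symm_apply_apply, ← Equiv.symm_apply_eq, ← Equiv.symm_apply_eq, Fin.lt_def,
      Fin.ext_iff, Fin.ext_iff]
    have := (x.symm v).isLt
    omega
  have hfwd_eq : ∀ v : V, {w | G.Adj v w ∧ v < w} = forwardNbrs G x (x.symm v) := by
    intro v
    ext w
    simp [forwardNbrs, hlt]
  have hbwd_eq : ∀ v : V, {w | G.Adj v w ∧ w < v} = backwardNbrs G x (x.symm v) := by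
    intro v
    ext w
    simp [backwardNbrs, hlt]
  have hyz : x i₀ < x j₀ := by
    rw [hlt, Equiv.symm_apply_apply, Equiv.symm_apply_apply, Fin.lt_def]
    omega
  have hmain := card_le_of_forward_backward (G := G) (k := k) (y := x i₀) (z := x j₀)
    (ρ := x ⟨0, by omega⟩) (by omega) hyz hij hcardlast
    (by
      intro v hv
      rw [hlt, Equiv.symm_apply_apply, Fin.lt_def] at hv
      have h2 := (hx.forward_mem (x.symm v) (by omega)).1
      rw [← hfwd_eq] at h2
      obtain ⟨a, b, ha, hb, hab⟩ := (Set.one_lt_ncard_iff (Set.toFinite _)).1 h2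
      exact ⟨a, b, hab, ha, hb⟩)
    (by
      intro v hv
      have h0 : 0 < (x.symm v : ℕ) := by
        rw [ne_eq, ← Equiv.symm_apply_eq, Fin.ext_iff] at hv
        exact Nat.pos_of_ne_zero hv
      have h1 := hx.backward_pos (x.symm v) h0
      rw [← hbwd_eq] at h1
      exact (Set.ncard_pos (Set.toFinite _)).1 h1)
    (by
      intro v
      rcases hcardlast v with hv | hv | hv
      · rw [hlt, Equiv.symm_apply_apply, Fin.lt_def] at hv
        rw [hfwd_eq]
        exact (hx.forward_mem (x.symm v) (by omega)).2
      · have hsub : {w | G.Adj v w ∧ v < w} ⊆ {x j₀} := by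
          rintro w ⟨-, hw⟩
          rcases hcardlast w with h1 | h1 | h1
          · exact absurd hw (hv ▸ h1.not_gt)
          · exact absurd hw (by rw [hv, h1]; exact lt_irrefl _)
          · exact h1
        have := Set.ncard_le_ncard hsub (Set.finite_singleton _)
        rw [Set.ncard_singleton] at this
        omega
      · have hemp : {w | G.Adj v w ∧ v < w} = ∅ := by
          refine Set.eq_empty_of_forall_notMem ?_
          rintro w ⟨-, hw⟩
          rw [hv] at hw
          rcases hcardlast w with h1 | h1 | h1
          · exact lt_irrefl _ ((hyz.trans hw).trans h1)
          · exact lt_irrefl _ (hyz.trans (h1 ▸ hw))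
          · exact lt_irrefl _ (h1 ▸ hw)
        rw [hemp, Set.ncard_empty]
        omega)
  rw [hV] at hmain
  set c := (cycleLengths G).ncard
  -- Rounding `k + 1` up to `4 * k` gives the base `8 * k`, whose logarithm is 3 + log k.
  have hpow : n ≤ (8 * k) ^ (c + 2) := by
    calc n ≤ 2 ^ (c + 2) * (k + 1) ^ c := hmain
      _ ≤ 2 ^ (c + 2) * (4 * k) ^ (c + 2) := by
          refine Nat.mul_le_mul_left _ ?_
          exact (Nat.pow_le_pow_left (by omega) c).trans
            (Nat.pow_le_pow_right (by omega) (by omega))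
      _ = (8 * k) ^ (c + 2) := by rw [← mul_pow]; ring_nf
  have hk0 : (0 : ℝ) < k := by exact_mod_cast (show 0 < k by omega)
  have hlogk : 0 ≤ Real.logb 2 k :=
    Real.logb_nonneg (by norm_num) (by exact_mod_cast (show 1 ≤ k by omega))
  have h8 : Real.logb 2 8 = 3 := by
    rw [show (8 : ℝ) = 2 ^ (3 : ℕ) by norm_num, Real.logb_pow, Real.logb_self_eq_one (by norm_num)]
    norm_num
  have hlog : Real.logb 2 n ≤ (c + 2 : ℝ) * (3 + Real.logb 2 k) := by
    calc Real.logb 2 n ≤ Real.logb 2 ((8 * k : ℝ) ^ (c + 2)) := by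
          refine Real.logb_le_logb_of_le (by norm_num) ?_ (by exact_mod_cast hpow)
          exact_mod_cast (show 0 < n by omega)
      _ = (c + 2 : ℝ) * (3 + Real.logb 2 k) := by
          rw [Real.logb_pow, Real.logb_mul (by norm_num) hk0.ne', h8]
          push_cast
          ring
  have := (div_le_iff₀ (by linarith : (0 : ℝ) < 3 + Real.logb 2 k)).2 hlog
  linarith

/-! ### Degree critical graphs are ordered -/

section DegreeCritical

variable {V : Type*} [Fintype V] {G : SimpleGraph V}

omit [Fintype V] in
theorem ncard_neighborSet_induce (S : Set V) (v : S) :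
    ((G.induce S).neighborSet v).ncard = (G.neighborSet v ∩ S).ncard := by
  rw [← Set.ncard_image_of_injective _ Subtype.val_injective]
  congr 1
  ext w
  simp only [Set.mem_image, SimpleGraph.mem_neighborSet, SimpleGraph.comap_adj,
    Function.Embedding.subtype_apply, Subtype.exists, exists_and_right, exists_eq_right,
    Set.mem_inter_iff]
  exact ⟨fun ⟨h1, h2⟩ => ⟨h2, h1⟩, fun ⟨h1, h2⟩ => ⟨h2, h1⟩⟩

/-- A proper set of vertices of a graph all of whose proper induced subgraphs have a vertex of
degree at most `m` admits a degenerate order. -/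
theorem exists_rank_of_forall_proper {m : ℕ}
    (hG : ∀ S : Set V, S.Nonempty → S ≠ Set.univ → ∃ v ∈ S, (G.neighborSet v ∩ S).ncard ≤ m)
    (W : Finset V) (hW : (W : Set V) ≠ Set.univ) :
    ∃ r : V → ℕ, Set.InjOn r W ∧
      ∀ a ∈ W, {w | w ∈ W ∧ G.Adj a w ∧ r a < r w}.ncard ≤ m := by
  classical
  induction hn : W.card using Nat.strong_induction_on generalizing W with
  | _ n ih =>
    rcases W.eq_empty_or_nonempty with rfl | hne
    · exact ⟨fun _ => 0, by simp, by simp⟩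
    obtain ⟨v, hv, hdeg⟩ := hG W (by simpa using hne) hW
    have hv' : v ∈ W := hv
    obtain ⟨r, hinj, hr⟩ := ih (W.erase v).card
      (hn ▸ Finset.card_erase_lt_of_mem hv') (W.erase v)
      (fun h => by
        have := Set.mem_univ v
        rw [← h] at this
        simp at this) rfl
    -- The vertex of small degree goes first with rank 0; the shift keeps the others above it.
    refine ⟨fun w => if w = v then 0 else r w + 1, ?_, ?_⟩
    · intro a ha b hb hab
      by_cases h1 : a = v <;> by_cases h2 : b = v <;> simp [h1, h2] at hab ⊢
      exact hinj (by simpa [h1] using ha) (by simpa [h2] using hb) hab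
    · intro a ha
      by_cases h1 : a = v
      · subst h1
        refine (Set.ncard_le_ncard (fun w hw => ?_) (Set.toFinite _)).trans hdeg
        exact ⟨hw.2.1, hw.1⟩
      · refine (Set.ncard_le_ncard (fun w hw => ?_) (Set.toFinite _)).trans
          (hr a (Finset.mem_erase.2 ⟨h1, ha⟩))
        obtain ⟨hw1, hw2, hw3⟩ := hw
        by_cases h2 : w = v
        · simp [h2] at hw3
        · simp only [h1, h2, if_false] at hw3
          exact ⟨Finset.mem_erase.2 ⟨h2, hw1⟩, hw2, by omega⟩

/-- Such a graph has an order that starts at a given vertex and is degenerate from there on. -/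
theorem exists_order_of_forall_proper {m n : ℕ} (hV : Fintype.card V = n)
    (hG : ∀ S : Set V, S.Nonempty → S ≠ Set.univ → ∃ v ∈ S, (G.neighborSet v ∩ S).ncard ≤ m)
    (v : V) : ∃ x : Fin n ≃ V, (∀ i : Fin n, (i : ℕ) = 0 → x i = v) ∧
      ∀ i : Fin n, 0 < (i : ℕ) → (forwardNbrs G x i).ncard ≤ m := by
  classical
  obtain ⟨r, hinj, hr⟩ := exists_rank_of_forall_proper hG (Finset.univ.erase v) (fun h => by
    have := Set.mem_univ v
    rw [← h] at this
    simp at this)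
  let r' : V → ℕ := fun w => if w = v then 0 else r w + 1
  have hinj' : Function.Injective r' := by
    intro a b hab
    by_cases h1 : a = v <;> by_cases h2 : b = v <;> simp [r', h1, h2] at hab ⊢
    exact hinj (by simpa using h1) (by simpa using h2) hab
  let _ : LinearOrder V := LinearOrder.lift' r' hinj'
  have hle : ∀ a b : V, a ≤ b ↔ r' a ≤ r' b := fun _ _ => Iff.rfl
  have hlt : ∀ a b : V, a < b ↔ r' a < r' b := fun _ _ => Iff.rfl
  let x := Fintype.orderIsoFinOfCardEq V hV
  have hx0 : ∀ i : Fin n, (i : ℕ) = 0 → x i = v := by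
    intro i hi
    have h1 : i ≤ x.symm v := by
      rw [Fin.le_def]
      omega
    have h2 : x i ≤ v := (OrderIso.le_symm_apply x).1 h1
    rw [hle] at h2
    by_contra hne
    simp [r', hne] at h2
  refine ⟨x.toEquiv, hx0, fun i hi => ?_⟩
  have hxi : x i ≠ v := by
    intro h
    have h2 := hx0 ⟨0, by omega⟩ rfl
    have := x.injective (h.trans h2.symm)
    rw [this] at hi
    exact lt_irrefl _ hi
  refine (Set.ncard_le_ncard (fun w hw => ?_) (Set.toFinite _)).trans
    (hr (x i) (by simpa using hxi))
  obtain ⟨hw1, hw2⟩ := hw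
  have hw3 : x i < w := x.lt_symm_apply.1 hw2
  rw [hlt] at hw3
  have hwv : w ≠ v := by
    rintro rfl
    simp [r'] at hw3
  simp only [r', hxi, hwv, if_false] at hw3
  exact ⟨by simpa using hwv, hw1, by omega⟩

theorem forwardNbrs_ncard_add_backwardNbrs_ncard {n : ℕ} (x : Fin n ≃ V) (i : Fin n) :
    (forwardNbrs G x i).ncard + (backwardNbrs G x i).ncard = (G.neighborSet (x i)).ncard := by
  rw [← Set.ncard_union_eq (Set.disjoint_left.2 fun w hw hw' => lt_asymm hw.2 hw'.2)
    (Set.toFinite _) (Set.toFinite _)]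
  congr 1
  ext w
  constructor
  · rintro (hw | hw) <;> exact hw.1
  · intro hw
    rcases lt_trichotomy i (x.symm w) with h | h | h
    · exact Or.inl ⟨hw, h⟩
    · rw [h, SimpleGraph.mem_neighborSet, Equiv.apply_symm_apply] at hw
      exact absurd hw (G.loopless.irrefl w)
    · exact Or.inr ⟨hw, h⟩

/-- Each edge is seen once from its earlier and once from its later end, so the forward and backward
sums agree and together make the degree sum. -/
theorem sum_forwardNbrs_ncard {n : ℕ} (x : Fin n ≃ V) :
    ∑ i, (forwardNbrs G x i).ncard = G.edgeSet.ncard := by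
  classical
  have hf : ∀ i, (forwardNbrs G x i).ncard =
      (Finset.univ.filter fun j => G.Adj (x i) (x j) ∧ i < j).card := by
    intro i
    rw [← Set.ncard_coe_finset, ← Set.ncard_image_of_injective _ x.injective]
    congr 1
    ext w
    simp only [forwardNbrs, Finset.coe_filter, Finset.mem_univ, true_and]
    constructor
    · intro hw
      exact ⟨x.symm w, by simpa using hw, by simp⟩
    · rintro ⟨j, hj, rfl⟩
      simpa using hj
  have hb : ∀ i, (backwardNbrs G x i).ncard =
      (Finset.univ.filter fun j => G.Adj (x j) (x i) ∧ j < i).card := by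
    intro i
    rw [← Set.ncard_coe_finset, ← Set.ncard_image_of_injective _ x.injective]
    congr 1
    ext w
    simp only [backwardNbrs, Finset.coe_filter, Finset.mem_univ, true_and]
    constructor
    · intro hw
      exact ⟨x.symm w, by simpa [G.adj_comm] using hw, by simp⟩
    · rintro ⟨j, hj, rfl⟩
      simpa [G.adj_comm] using hj
  have hfb : ∑ i, (forwardNbrs G x i).ncard = ∑ i, (backwardNbrs G x i).ncard := by
    simp only [hf, hb]
    exact Finset.sum_card_bipartiteAbove_eq_sum_card_bipartiteBelow
      (s := Finset.univ) (t := Finset.univ) (fun i j => G.Adj (x i) (x j) ∧ i < j)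
  have hdeg : ∑ i, (forwardNbrs G x i).ncard + ∑ i, (backwardNbrs G x i).ncard =
      2 * G.edgeSet.ncard := by
    rw [← Finset.sum_add_distrib]
    simp only [forwardNbrs_ncard_add_backwardNbrs_ncard]
    rw [Equiv.sum_comp x fun v => (G.neighborSet v).ncard, ← SimpleGraph.coe_edgeFinset,
      Set.ncard_coe_finset, ← G.sum_degrees_eq_twice_card_edges]
    refine Finset.sum_congr rfl fun v _ => ?_
    rw [← SimpleGraph.card_neighborFinset_eq_degree, ← Set.ncard_coe_finset,
      SimpleGraph.coe_neighborFinset]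
  omega

omit [Fintype V] in
theorem forwardNbrs_ncard_le {n : ℕ} (x : Fin n ≃ V) (i : Fin n) :
    (forwardNbrs G x i).ncard ≤ n - 1 - i := by
  rw [← Fin.card_Ioi, ← Set.ncard_coe_finset,
    ← Set.ncard_image_of_injective _ x.symm.injective]
  refine Set.ncard_le_ncard ?_ (Set.toFinite _)
  rintro _ ⟨w, hw, rfl⟩
  simpa using hw.2

/-- With `j` vertices still to come, a vertex has at most `min (k - 1) j` forward neighbours in a
degenerate order. The sum is one less than the critical edge count. -/
theorem sum_range_min_add_choose (k n : ℕ) (hn : k ≤ n) :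
    ∑ j ∈ Finset.range n, min (k - 1) j + k.choose 2 = (k - 1) * n := by
  induction n, hn using Nat.le_induction with
  | base =>
    rw [Finset.sum_congr rfl fun j hj => min_eq_right (by have := Finset.mem_range.1 hj; omega),
      Finset.sum_range_id, Nat.choose_two_right]
    have := Nat.div_mul_cancel (even_iff_two_dvd.1 (Nat.even_mul_pred_self k))
    rw [mul_comm (k - 1)]
    omega
  | succ n hn ih =>
    rw [Finset.sum_range_succ, min_eq_left (by omega), mul_add, mul_one]
    omega

theorem IsDegreeCritical.exists_isKOrdered {k n : ℕ} (hG : IsDegreeCritical k G) (hk : 3 ≤ k)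
    (hn : k + 1 ≤ n) (hV : Fintype.card V = n) : ∃ x : Fin n ≃ V, IsKOrdered k G x := by
  classical
  have hproper : ∀ S : Set V, S.Nonempty → S ≠ Set.univ →
      ∃ v ∈ S, (G.neighborSet v ∩ S).ncard ≤ k - 1 := by
    intro S h1 h2
    by_contra! hcon
    refine hG.no_proper ⟨S, h1, h2, fun v => ?_⟩
    rw [ncard_neighborSet_induce]
    have := hcon v v.2
    omega
  have hsum : ∑ i : Fin n, min (k - 1) (n - 1 - (i : ℕ)) + 1 = G.edgeSet.ncard := by
    have h1 := sum_range_min_add_choose k n (by omega)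
    rw [← Finset.sum_range_reflect, Finset.sum_range] at h1
    have h2 := hG.card_edges
    rw [Nat.card_eq_fintype_card, hV] at h2
    have h3 : ((k : ℤ) - 1) * n = (((k - 1) * n : ℕ) : ℤ) := by
      push_cast [Nat.cast_sub (show 1 ≤ k by omega)]
      ring
    rw [h3, ← h1] at h2
    push_cast at h2
    have h4 : ((∑ i : Fin n, min (k - 1) (n - 1 - (i : ℕ)) + 1 : ℕ) : ℤ) = G.edgeSet.ncard := by
      push_cast
      linarith
    exact_mod_cast h4
  let i₀ : Fin n := ⟨0, by omega⟩
  -- All vertices but the first obey the bounds summed in `hsum`, so the surplus edge forces the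
  -- first one above its own bound `k - 1`.
  have hdeg : ∀ v, ∃ x : Fin n ≃ V, x i₀ = v ∧
      (∀ i, i ≠ i₀ → (forwardNbrs G x i).ncard ≤ min (k - 1) (n - 1 - (i : ℕ))) ∧
      k ≤ (forwardNbrs G x i₀).ncard := by
    intro v
    obtain ⟨x, hx0, hx⟩ := exists_order_of_forall_proper hV hproper v
    have hle : ∀ i, i ≠ i₀ → (forwardNbrs G x i).ncard ≤ min (k - 1) (n - 1 - (i : ℕ)) := by
      intro i hi
      refine le_min (hx i ?_) (forwardNbrs_ncard_le x i)
      exact Nat.pos_of_ne_zero fun h => hi (Fin.ext h)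
    refine ⟨x, hx0 i₀ rfl, hle, ?_⟩
    have h1 := sum_forwardNbrs_ncard (G := G) x
    rw [← hsum, ← Finset.add_sum_erase _ _ (Finset.mem_univ i₀),
      ← Finset.add_sum_erase _ (fun i : Fin n => min (k - 1) (n - 1 - (i : ℕ)))
        (Finset.mem_univ i₀)] at h1
    have h2 := Finset.sum_le_sum (s := Finset.univ.erase i₀)
      fun i hi => hle i (Finset.ne_of_mem_erase hi)
    have h3 : min (k - 1) (n - 1 - (i₀ : ℕ)) = k - 1 := min_eq_left (by
      show k - 1 ≤ n - 1 - 0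
      omega)
    omega
  have hmin : ∀ v, k ≤ (G.neighborSet v).ncard := by
    intro v
    obtain ⟨x, rfl, -, h⟩ := hdeg v
    have := forwardNbrs_ncard_add_backwardNbrs_ncard (G := G) x i₀
    omega
  -- Deleting any vertex leaves some vertex with degree at most `k - 1`, hence at most `k` in `G`.
  obtain ⟨v, hv⟩ : ∃ v, (G.neighborSet v).ncard ≤ k := by
    by_contra! hcon
    have : Nontrivial V := Fintype.one_lt_card_iff_nontrivial.1 (by omega)
    obtain ⟨a, b, hab⟩ := exists_pair_ne V
    obtain ⟨v, hv, hdeg⟩ := hproper {a}ᶜ ⟨b, hab.symm⟩ (fun h => by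
      have := Set.mem_univ a
      rw [← h] at this
      exact this rfl)
    have h1 := hcon v
    have h2 : (G.neighborSet v).ncard ≤ (insert a (G.neighborSet v ∩ {a}ᶜ)).ncard := by
      refine Set.ncard_le_ncard (fun w hw => ?_) (Set.toFinite _)
      by_cases hwa : w = a
      · exact Or.inl hwa
      · exact Or.inr ⟨hw, hwa⟩
    have h3 := Set.ncard_insert_le a (G.neighborSet v ∩ {a}ᶜ)
    omega
  obtain ⟨x, rfl, hle, hk0⟩ := hdeg v
  have hsplit := forwardNbrs_ncard_add_backwardNbrs_ncard (G := G) x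
  have h0 : (forwardNbrs G x i₀).ncard = k := by
    have := hsplit i₀
    omega
  -- The first vertex uses exactly its bound plus the surplus edge, so no other vertex has slack.
  have htight : ∀ i, i ≠ i₀ → (forwardNbrs G x i).ncard = min (k - 1) (n - 1 - (i : ℕ)) := by
    have h1 := sum_forwardNbrs_ncard (G := G) x
    rw [← hsum, ← Finset.add_sum_erase _ _ (Finset.mem_univ i₀),
      ← Finset.add_sum_erase _ (fun i : Fin n => min (k - 1) (n - 1 - (i : ℕ)))
        (Finset.mem_univ i₀)] at h1
    have h3 : min (k - 1) (n - 1 - (i₀ : ℕ)) = k - 1 := min_eq_left (by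
      show k - 1 ≤ n - 1 - 0
      omega)
    have h4 := (Finset.sum_eq_sum_iff_of_le (s := Finset.univ.erase i₀)
      fun i hi => hle i (Finset.ne_of_mem_erase hi)).1 (by omega)
    exact fun i hi => h4 i (Finset.mem_erase.2 ⟨hi, Finset.mem_univ i⟩)
  refine ⟨x, ⟨?_, ?_, ?_⟩⟩
  -- The last vertex but one has a forward neighbour by tightness, and only the last vertex can be
  -- it.
  · let i : Fin n := ⟨n - 2, by omega⟩
    have hi : (i : ℕ) = n - 2 := rfl
    have h1 := htight i (by
      rw [ne_eq, Fin.ext_iff]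
      show ¬ n - 2 = 0
      omega)
    have h2 : 0 < (forwardNbrs G x i).ncard := by
      rw [h1]
      exact lt_min (by omega) (by omega)
    obtain ⟨w, hw1, hw2⟩ := (Set.ncard_pos (Set.toFinite _)).1 h2
    rw [Fin.lt_def] at hw2
    have := (x.symm w).isLt
    exact ⟨i, x.symm w, by omega, by omega, by simpa using hw1⟩
  · intro i hi
    by_cases hi0 : i = i₀
    · rw [hi0, h0]
      exact ⟨by omega, le_rfl⟩
    · rw [htight i hi0]
      exact ⟨le_min (by omega) (by omega), (min_le_left _ _).trans (by omega)⟩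
  · intro i hi
    have hi0 : i ≠ i₀ := fun h => by
      rw [h] at hi
      exact lt_irrefl _ hi
    have h1 := hsplit i
    have h2 := hmin (x i)
    have h3 := (hle i hi0).trans (min_le_left _ _)
    omega

end DegreeCritical

theorem mainTheorem2 {V : Type*} [Fintype V] (G : SimpleGraph V) (k n : ℕ)
    (hk : 3 ≤ k) (hn : k + 1 ≤ n) (hV : Fintype.card V = n) :
    (∀ x : Fin n ≃ V, IsKOrdered k G x →
      Real.logb 2 n / (3 + Real.logb 2 k) - 2 ≤ ((cycleLengths G).ncard : ℝ)) ∧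
    (IsDegreeCritical k G →
      (∃ x : Fin n ≃ V, IsKOrdered k G x) ∧
      Real.logb 2 n / (3 + Real.logb 2 k) - 2 ≤ ((cycleLengths G).ncard : ℝ)) := by
  refine ⟨fun x hx => logb_le_of_isKOrdered G k n hk hV x hx, fun hG => ?_⟩
  obtain ⟨x, hx⟩ := hG.exists_isKOrdered hk hn hV
  exact ⟨⟨x, hx⟩, logb_le_of_isKOrdered G k n hk hV x hx⟩
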